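/- Let $d,L,d_0,n$ be integers with $L\ge 2$ and $1\le d_0\le d$. For $B\in\mathbb R^{d\times L}$ with columns $\beta_1,\dots,\beta_L$ such that $\beta_L=0$ and at most $d_0$ rows of $B$ are nonzero, and for a probability distribution $P_X$ on $\mathbb R^d$ under which the $d$ features are linearly independent (no nontrivial linear combination of the coordinates of $X$ vanishes $P_X$-almost surely), consider the $d_0$-sparse multinomial logistic regression model: $X\sim P_X$ and $$P(Y=l\mid X=x)=\frac{\exp(\beta_l^Tx)}{\sum_{k=1}^L\exp(\beta_k^Tx)},\qquad l=1,\dots,L.$$ Its Bayes classifier is the linear classifier $\eta^*(x)=\arg\max_{1\le l\le L}\beta_l^Tx$, and its Bayes risk is positive. For a classifier $\eta$ let $R(\eta)=P(Y\ne\eta(X))$. For a classifier $\widetilde\eta$ based on $n$ independent observations $(X_1,Y_1),\dots,(X_n,Y_n)$ from the distribution of $(X,Y)$ let $\mathcal E(\widetilde\eta,\eta^*)=E\,R(\widetilde\eta)-R(\eta^*)$ be its misclassification excess risk, the expectation being over the sample. There is an absolute constant $C_2>0$ such that, whenever $2\le d_0\ln(de/d_0)\le n$ and $d_0(L-1)\le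 n$, and in addition $d_0\ge 2$ or $L=2$, $$\inf_{\widetilde\eta}\ \sup_{\eta^*,\,P_X}\ \mathcal E(\widetilde\eta,\eta^*)\ \ge\ C_2\sqrt{\frac{d_0(L-1)+d_0\ln\left(\frac{de}{d_0}\right)}{n}},$$ where the infimum is over all classifiers $\widetilde\eta$ based on the $n$ observations, and the supremum is over all matrices $B$ as above, with their Bayes classifiers $\eta^*$, and all $P_X$ as above. -/

import Mathlib

open MeasureTheory

noncomputable section

namespace SparseMultinomial

/-- Feature vectors in `ℝ^d`; only the (product = Borel) measurable structure is used. -/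
abbrev Feat (d : ℕ) : Type := Fin d → ℝ

/-- The linear score `β_lᵀ x`, where `β_l` is the `l`-th column of `B ∈ ℝ^{d × L}`. -/
def score {d L : ℕ} (B : Matrix (Fin d) (Fin L) ℝ) (x : Feat d) (l : Fin L) : ℝ :=
  ∑ j, B j l * x j

/-- The conditional class probability
`p_l(x) = exp (β_lᵀ x) / ∑_k exp (β_kᵀ x)`. -/
def classProb {d L : ℕ} (B : Matrix (Fin d) (Fin L) ℝ) (x : Feat d) (l : Fin L) : ℝ :=
  Real.exp (score B x l) / ∑ k, Real.exp (score B x k)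

/-- The number `r_B` of nonzero rows of `B`. -/
def nonzeroRows {d L : ℕ} (B : Matrix (Fin d) (Fin L) ℝ) : ℕ :=
  {j : Fin d | ∃ l, B j l ≠ 0}.ncard

/-- Admissible regression matrices: the column of the last (reference) class vanishes, and at
most `d₀` rows are nonzero. -/
def IsSparseCoef {d L : ℕ} (d₀ : ℕ) (B : Matrix (Fin d) (Fin L) ℝ) : Prop :=
  (∀ l : Fin L, (l : ℕ) + 1 = L → ∀ j, B j l = 0) ∧ nonzeroRows B ≤ d₀

/-- Admissible marginal laws `P_X`: probability measures on `ℝ^d` under which the `d` features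
are linearly independent (no nontrivial linear combination of them vanishes almost surely). -/
def IsMarginal {d : ℕ} (P : Measure (Feat d)) : Prop :=
  IsProbabilityMeasure P ∧ ∀ v : Fin d → ℝ, (∀ᵐ x ∂P, ∑ j, v j * x j = 0) → v = 0

/-- The joint law of `(X, Y)`: `X ~ P`, and `Y` given `X = x` equals `l` with probability
`p_l(x)`, that is, the law with density `(x, y) ↦ p_y(x)` with respect to `P ⊗ counting`. -/
def jointLaw {d L : ℕ} (B : Matrix (Fin d) (Fin L) ℝ) (P : Measure (Feat d)) :
    Measure (Feat d × Fin L) :=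
  (P.prod Measure.count).withDensity fun z => ENNReal.ofReal (classProb B z.1 z.2)

/-- `η` is a (measurable version of the) linear classifier `x ↦ argmax_l β_lᵀ x`. Ties may be
broken in any measurable way. -/
def IsLinearClassifier {d L : ℕ} (B : Matrix (Fin d) (Fin L) ℝ) (η : Feat d → Fin L) : Prop :=
  Measurable η ∧ ∀ x l, score B x l ≤ score B x (η x)

/-- The misclassification error `R(η) = P(Y ≠ η(X))`. -/
def risk {d L : ℕ} (B : Matrix (Fin d) (Fin L) ℝ) (P : Measure (Feat d))
    (η : Feat d → Fin L) : ℝ :=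
  (jointLaw B P).real {z | z.2 ≠ η z.1}

/-- A classifier based on `n` labelled observations: a map sending the sample and a new feature
vector to a label, measurable in both arguments jointly. -/
def DataClassifier (d L n : ℕ) : Type :=
  {η : (Fin n → Feat d × Fin L) → Feat d → Fin L // Measurable (Function.uncurry η)}

/-- The misclassification excess risk `E R(η̃) - R(η*)`, the expectation being over `n`
independent observations from the joint law of `(X, Y)`. -/
def excessRisk {d L n : ℕ} (B : Matrix (Fin d) (Fin L) ℝ) (P : Measure (Feat d))
    (ηt : DataClassifier d L n) (ηs : Feat d → Fin L) : ℝ :=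
  (∫ D, risk B P (ηt.1 D) ∂(Measure.pi fun _ : Fin n => jointLaw B P)) - risk B P ηs

/-- The minimax misclassification excess risk: infimum over all classifiers based on `n`
observations, supremum over all `d₀`-sparse multinomial logistic models (coefficient matrix `B`
with its linear Bayes classifier `η*`, and marginal law `P_X`). The extended reals are used only
as a complete lattice. -/
def minimaxExcessRisk (d L d₀ n : ℕ) : EReal :=
  ⨅ ηt : DataClassifier d L n,
    ⨆ (B : Matrix (Fin d) (Fin L) ℝ) (_ : IsSparseCoef d₀ B)
      (ηs : Feat d → Fin L) (_ : IsLinearClassifier B ηs)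
      (P : Measure (Feat d)) (_ : IsMarginal P),
      ((excessRisk B P ηt ηs : ℝ) : EReal)

end SparseMultinomial

end

noncomputable section

namespace SparseMultinomial

/-! The bound is Assouad's method with a finitely supported `P_X`. Take `V` points, each with two
competing classes, such that every sign pattern `σ` is realised by a `d₀`-sparse matrix: at the
`i`-th point the two scores differ by `t` in the direction `σ i`, and all other classes have
negligible probability (`IsDesign`). With `P_X` nearly uniform on these points, flipping one sign
moves the law of one observation by a squared Hellinger distance of order `t ^ 2 / V`. Hence if `n *
t ^ 2` is at most of order `V`, some `σ` has a constant expected fraction of its signs misread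
(`exists_sum_error_ge`). Each misreading costs order `t` at its point, so the excess risk is of
order `t`, that is `√(V / n)` (`IsDesign.exists_excessRisk_ge`). A small mass on the unit vectors
makes the features linearly independent.

It remains to find designs with `V` of the order of the larger of the two terms. For the logarithmic
term, about `d₀` blocks of `2 ^ q` coordinates are indexed by the vertices of a cube, and one
nonzero row per block realises all sign patterns on `q + 1` points (`isDesign_cubePoint`). For `d₀ *
(L - 1)`, the classes form about `L / 2` pairs whose scores are tangent lines of a parabola, so that
each pair dominates at its own position; the intercept and the `d₀ - 2` further rows leave `d₀ - 1`
free signs per pair (`isDesign_parabolaPoint`). -/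

/-- The finitely supported measure with mass `w k` at `y k`. -/
def atomic {κ E : Type*} [Fintype κ] [MeasurableSpace E] (w : κ → ℝ) (y : κ → E) : Measure E :=
  ∑ k, ENNReal.ofReal (w k) • Measure.dirac (y k)

/-! ### Finitely supported measures and their products -/

section Atomic

variable {κ E : Type*} [Fintype κ] [MeasurableSpace E]

lemma atomic_apply (w : κ → ℝ) (y : κ → E) {s : Set E} (hs : MeasurableSet s) :
    atomic w y s = ∑ k, ENNReal.ofReal (w k) * s.indicator 1 (y k) := by
  simp [atomic, Measure.finsetSum_apply, Measure.dirac_apply' _ hs]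

instance isFiniteMeasure_atomic (w : κ → ℝ) (y : κ → E) : IsFiniteMeasure (atomic w y) := by
  refine ⟨?_⟩
  rw [atomic_apply _ _ MeasurableSet.univ]
  simp [ENNReal.sum_lt_top]

lemma isProbabilityMeasure_atomic {w : κ → ℝ} (hw : ∀ k, 0 ≤ w k) (h1 : ∑ k, w k = 1)
    (y : κ → E) : IsProbabilityMeasure (atomic w y) := by
  refine ⟨?_⟩
  rw [atomic_apply _ _ MeasurableSet.univ]
  simp [← ENNReal.ofReal_sum_of_nonneg fun k _ => hw k, h1]

lemma lintegral_atomic (w : κ → ℝ) (y : κ → E) {f : E → ENNReal} (hf : Measurable f) :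
    ∫⁻ x, f x ∂(atomic w y) = ∑ k, ENNReal.ofReal (w k) * f (y k) := by
  simp [atomic, lintegral_finsetSum_measure, lintegral_smul_measure, lintegral_dirac' _ hf]

lemma integral_atomic [MeasurableSingletonClass E] {w : κ → ℝ} (hw : ∀ k, 0 ≤ w k) (y : κ → E)
    (f : E → ℝ) : ∫ x, f x ∂(atomic w y) = ∑ k, w k * f (y k) := by
  rw [atomic, integral_finsetSum_measure]
  · simp [integral_smul_measure, ENNReal.toReal_ofReal (hw _)]
  · intro k _
    exact (integrable_dirac (by simp)).smul_measure ENNReal.ofReal_ne_top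

lemma atomic_real {w : κ → ℝ} (hw : ∀ k, 0 ≤ w k) (y : κ → E) {s : Set E}
    (hs : MeasurableSet s) : (atomic w y).real s = ∑ k, w k * s.indicator 1 (y k) := by
  rw [Measure.real, atomic_apply _ _ hs, ENNReal.toReal_sum]
  · refine Finset.sum_congr rfl fun k _ => ?_
    by_cases h : y k ∈ s <;> simp [h, hw k]
  · intro k _
    by_cases h : y k ∈ s <;> simp [h]

lemma pi_atomic {n : ℕ} {w : κ → ℝ} (hw : ∀ k, 0 ≤ w k) (y : κ → E) :
    (Measure.pi fun _ : Fin n => atomic w y) =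
      atomic (fun s : Fin n → κ => ∏ i, w (s i)) (fun s i => y (s i)) := by
  classical
  refine Measure.pi_eq fun S hS => ?_
  rw [atomic_apply _ _ (MeasurableSet.univ_pi hS)]
  simp_rw [atomic_apply _ _ (hS _)]
  rw [Finset.prod_univ_sum, Fintype.piFinset_univ]
  refine Finset.sum_congr rfl fun s _ => ?_
  rw [Finset.prod_mul_distrib, ENNReal.ofReal_prod_of_nonneg fun i _ => hw _]
  congr 1
  by_cases h : ∀ i, y (s i) ∈ S i
  · rw [Set.indicator_of_mem (by simpa using h)]
    simp [Set.indicator_of_mem (h _)]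
  · rw [Set.indicator_of_notMem (by simpa using h)]
    push Not at h
    obtain ⟨i, hi⟩ := h
    exact (Finset.prod_eq_zero (Finset.mem_univ i) (by simp [hi])).symm

end Atomic

/-! ### Risks in the logistic model with a finitely supported marginal -/

variable {d L : ℕ}

lemma measurable_score (B : Matrix (Fin d) (Fin L) ℝ) (l : Fin L) :
    Measurable fun x => score B x l := by
  unfold score; fun_prop

lemma classProb_nonneg (B : Matrix (Fin d) (Fin L) ℝ) (x : Feat d) (l : Fin L) :
    0 ≤ classProb B x l := by
  unfold classProb; positivity

lemma sum_classProb [NeZero L] (B : Matrix (Fin d) (Fin L) ℝ) (x : Feat d) :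
    ∑ l, classProb B x l = 1 := by
  unfold classProb
  rw [← Finset.sum_div, div_self]
  exact (Finset.sum_pos (fun _ _ => Real.exp_pos _) Finset.univ_nonempty).ne'

lemma classProb_le_classProb {B : Matrix (Fin d) (Fin L) ℝ} {x : Feat d} {k l : Fin L}
    (h : score B x k ≤ score B x l) : classProb B x k ≤ classProb B x l := by
  unfold classProb; gcongr

lemma measurable_classProb (B : Matrix (Fin d) (Fin L) ℝ) :
    Measurable fun z : Feat d × Fin L => classProb B z.1 z.2 := by
  refine measurable_from_prod_countable_left fun l => ?_
  have := measurable_score B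
  exact (this l).exp.div (Finset.measurable_fun_sum _ fun k _ => (this k).exp)

/-- Every coefficient matrix has a measurable linear classifier. -/
lemma exists_isLinearClassifier [NeZero L] (B : Matrix (Fin d) (Fin L) ℝ) :
    ∃ η, IsLinearClassifier B η := by
  classical
  -- Ties go to the smallest index, which makes the argmax measurable.
  have hex : ∀ x : Feat d, ∃ N : ℕ, ∃ h : N < L, ∀ k, score B x k ≤ score B x ⟨N, h⟩ := by
    intro x
    obtain ⟨l, -, hl⟩ := Finset.exists_max_image Finset.univ (score B x) Finset.univ_nonempty
    exact ⟨l, l.2, fun k => hl k (Finset.mem_univ k)⟩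
  have hm : Measurable fun x => Nat.find (hex x) := by
    refine measurable_find hex fun N => ?_
    by_cases h : N < L
    · simp only [h, exists_true_left, Set.ofPred_forall]
      exact MeasurableSet.iInter fun k =>
        measurableSet_le (measurable_score B k) (measurable_score B _)
    · simp [h]
  refine ⟨fun x => ⟨Nat.find (hex x), (Nat.find_spec (hex x)).1⟩, ?_, fun x l =>
    (Nat.find_spec (hex x)).2 l⟩
  refine measurable_to_countable' fun l => ?_
  convert hm (measurableSet_singleton (l : ℕ)) using 1
  ext x
  simp [Fin.ext_iff]

section Atomic

variable {κ : Type*} [Fintype κ]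

lemma jointLaw_atomic (B : Matrix (Fin d) (Fin L) ℝ) {w : κ → ℝ} (hw : ∀ k, 0 ≤ w k)
    (y : κ → Feat d) :
    jointLaw B (atomic w y) =
      atomic (fun z : κ × Fin L => w z.1 * classProb B (y z.1) z.2) (fun z => (y z.1, z.2)) := by
  ext s hs
  have hf : Measurable fun z : Feat d × Fin L =>
      s.indicator (fun z => ENNReal.ofReal (classProb B z.1 z.2)) z :=
    (measurable_classProb B).ennreal_ofReal.indicator hs
  rw [jointLaw, withDensity_apply _ hs, ← lintegral_indicator hs,
    lintegral_prod _ hf.aemeasurable, lintegral_atomic _ _ hf.lintegral_prod_right',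
    atomic_apply _ _ hs, Fintype.sum_prod_type]
  refine Finset.sum_congr rfl fun k _ => ?_
  rw [lintegral_count, tsum_fintype, Finset.mul_sum]
  refine Finset.sum_congr rfl fun l _ => ?_
  by_cases h : (y k, l) ∈ s <;> simp [h, ENNReal.ofReal_mul (hw k)]

lemma risk_atomic [NeZero L] (B : Matrix (Fin d) (Fin L) ℝ) {w : κ → ℝ} (hw : ∀ k, 0 ≤ w k)
    (y : κ → Feat d) {η : Feat d → Fin L} (hη : Measurable η) :
    risk B (atomic w y) η = ∑ k, w k * (1 - classProb B (y k) (η (y k))) := by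
  have hs : MeasurableSet {z : Feat d × Fin L | z.2 ≠ η z.1} :=
    (measurableSet_eq_fun measurable_snd (hη.comp measurable_fst)).compl
  rw [risk, jointLaw_atomic B hw,
    atomic_real (fun z => mul_nonneg (hw _) (classProb_nonneg _ _ _)) _ hs,
    Fintype.sum_prod_type]
  refine Finset.sum_congr rfl fun k _ => ?_
  rw [← sum_classProb B (y k), ← Finset.sum_erase_eq_sub (Finset.mem_univ _), Finset.mul_sum,
    ← Finset.add_sum_erase _ _ (Finset.mem_univ (η (y k)))]
  simp only [Set.indicator, Set.mem_ofPred_eq, ne_eq, not_true_eq_false, if_false, mul_zero,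
    zero_add]
  refine Finset.sum_congr rfl fun l hl => ?_
  simp [Finset.ne_of_mem_erase hl]

/-- The excess risk of a data classifier under a finitely supported marginal law. -/
lemma excessRisk_atomic [NeZero L] {n : ℕ} {B : Matrix (Fin d) (Fin L) ℝ} {w : κ → ℝ}
    (hw : ∀ k, 0 ≤ w k) (h1 : ∑ k, w k = 1) (y : κ → Feat d) (ηt : DataClassifier d L n)
    {ηs : Feat d → Fin L} (hηs : Measurable ηs) :
    excessRisk B (atomic w y) ηt ηs =
      ∑ s : Fin n → κ × Fin L, (∏ i, w (s i).1 * classProb B (y (s i).1) (s i).2) *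
        ∑ k, w k * (classProb B (y k) (ηs (y k)) -
          classProb B (y k) (ηt.1 (fun i => (y (s i).1, (s i).2)) (y k))) := by
  classical
  have hp : ∀ z : κ × Fin L, 0 ≤ w z.1 * classProb B (y z.1) z.2 :=
    fun z => mul_nonneg (hw _) (classProb_nonneg _ _ _)
  have hone : ∑ s : Fin n → κ × Fin L, ∏ i, w (s i).1 * classProb B (y (s i).1) (s i).2 = 1 := by
    have := (Finset.prod_univ_sum (fun _ : Fin n => (Finset.univ : Finset (κ × Fin L)))
      fun _ z => w z.1 * classProb B (y z.1) z.2).symm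
    rw [Fintype.piFinset_univ] at this
    rw [this, Fintype.sum_prod_type]
    simp [← Finset.mul_sum, sum_classProb, h1]
  rw [excessRisk, jointLaw_atomic B hw, pi_atomic hp,
    integral_atomic (fun s => Finset.prod_nonneg fun i _ => hp _),
    ← one_mul (risk B _ ηs), ← hone, Finset.sum_mul, ← Finset.sum_sub_distrib]
  refine Finset.sum_congr rfl fun s _ => ?_
  rw [← mul_sub, risk_atomic B hw _ hηs, risk_atomic B hw y (ηt.2.of_uncurry_left),
    ← Finset.sum_sub_distrib]
  congr 1
  refine Finset.sum_congr rfl fun k _ => ?_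
  ring

end Atomic

/-! ### Assouad's lemma -/

/-- Assouad's bound: in a family of `n`-fold products of (sub-)probability vectors indexed by the
hypercube, neighbours of which have Hellinger affinity at least `α`, every sequence of tests has
a large total error at some vertex. -/
lemma exists_sum_error_ge {ι Ω : Type*} [Fintype ι] [DecidableEq ι] [Fintype Ω] {n : ℕ}
    {p : (ι → Bool) → Ω → ℝ} (hp : ∀ σ ω, 0 ≤ p σ ω) (hp1 : ∀ σ, ∑ ω, p σ ω ≤ 1)
    {α : ℝ} (hα : 0 ≤ α)
    (haff : ∀ σ i, α ≤ ∑ ω, √(p σ ω * p (Function.update σ i (!σ i)) ω))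
    (T : ι → (Fin n → Ω) → Bool) :
    ∃ σ, Fintype.card ι * (α ^ (2 * n) / 4) ≤
      ∑ i, ∑ s : Fin n → Ω, (∏ k, p σ (s k)) * if T i s ≠ σ i then 1 else 0 := by
  classical
  set P : (ι → Bool) → (Fin n → Ω) → ℝ := fun σ s => ∏ k, p σ (s k) with hP
  have hP0 : ∀ σ s, 0 ≤ P σ s := fun σ s => Finset.prod_nonneg fun k _ => hp _ _
  have hprod : ∀ f : Ω → ℝ, ∑ s : Fin n → Ω, ∏ k, f (s k) = (∑ ω, f ω) ^ n := by
    intro f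
    have := (Finset.prod_univ_sum (fun _ : Fin n => (Finset.univ : Finset Ω)) fun _ => f).symm
    rw [Fintype.piFinset_univ] at this
    simp [this]
  have hP1 : ∀ σ, ∑ s, P σ s ≤ 1 := fun σ => by
    rw [hprod]
    exact pow_le_one₀ (Finset.sum_nonneg fun _ _ => hp _ _) (hp1 σ)
  set fl : ι → (ι → Bool) → (ι → Bool) := fun i σ => Function.update σ i (!σ i) with hfl
  have hinv : ∀ i, Function.Involutive (fl i) := by
    intro i σ
    simp [hfl]
  -- Le Cam's inequality: by Cauchy–Schwarz the squared affinity is at most `∑ min * ∑ max`, where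
  -- `∑ max ≤ 2`; affinities of products multiply.
  have hmin : ∀ i σ, α ^ (2 * n) / 2 ≤ ∑ s, min (P σ s) (P (fl i σ) s) := by
    intro i σ
    have h1 : α ^ n ≤ ∑ s, √(P σ s * P (fl i σ) s) := by
      calc α ^ n ≤ (∑ ω, √(p σ ω * p (fl i σ) ω)) ^ n := by
            gcongr; exact haff σ i
        _ = ∑ s : Fin n → Ω, ∏ k, √(p σ (s k) * p (fl i σ) (s k)) := (hprod _).symm
        _ = _ := by
            refine Finset.sum_congr rfl fun s _ => ?_
            rw [hP, ← Finset.prod_mul_distrib, Real.sqrt_eq_rpow,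
              ← Real.finsetProd_rpow _ _ fun k _ => mul_nonneg (hp _ _) (hp _ _)]
            simp [Real.sqrt_eq_rpow]
    have h2 : (∑ s, √(P σ s * P (fl i σ) s)) ^ 2 ≤
        (∑ s, min (P σ s) (P (fl i σ) s)) * ∑ s, max (P σ s) (P (fl i σ) s) := by
      refine Finset.sum_sq_le_sum_mul_sum_of_sq_le_mul _
        (fun s _ => le_min (hP0 _ _) (hP0 _ _)) (fun s _ => le_max_of_le_left (hP0 _ _))
        fun s _ => ?_
      rw [Real.sq_sqrt (mul_nonneg (hP0 _ _) (hP0 _ _)), min_mul_max]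
    have h3 : ∑ s, max (P σ s) (P (fl i σ) s) ≤ 2 := by
      calc _ ≤ ∑ s, (P σ s + P (fl i σ) s) :=
            Finset.sum_le_sum fun s _ => max_le_add_of_nonneg (hP0 _ _) (hP0 _ _)
        _ ≤ 2 := by
            rw [Finset.sum_add_distrib]
            linarith [hP1 σ, hP1 (fl i σ)]
    have h4 : 0 ≤ ∑ s, min (P σ s) (P (fl i σ) s) :=
      Finset.sum_nonneg fun s _ => le_min (hP0 _ _) (hP0 _ _)
    have h5 : α ^ (2 * n) ≤ (∑ s, √(P σ s * P (fl i σ) s)) ^ 2 := by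
      rw [mul_comm, pow_mul]
      gcongr
    nlinarith
  set e : ι → (ι → Bool) → ℝ := fun i σ => ∑ s, P σ s * if T i s ≠ σ i then 1 else 0 with he
  have hpair : ∀ i σ, α ^ (2 * n) / 2 ≤ e i σ + e i (fl i σ) := by
    intro i σ
    refine (hmin i σ).trans ?_
    rw [he, ← Finset.sum_add_distrib]
    refine Finset.sum_le_sum fun s _ => ?_
    have hi : fl i σ i = !σ i := by simp [hfl]
    rw [hi]
    by_cases h : T i s = σ i
    · have : T i s ≠ !σ i := by rw [h]; simp
      simp [h]
    · have : T i s = !σ i := by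
        cases h1 : T i s <;> cases h2 : σ i <;> simp_all
      simp [this]
  -- Averaging over the cube: the flip is a bijection, so the bound on each pair of neighbours
  -- halves.
  have hi : ∀ i, ∑ _σ : ι → Bool, α ^ (2 * n) / 4 ≤ ∑ σ, e i σ := by
    intro i
    have h1 : ∑ σ, e i (fl i σ) = ∑ σ, e i σ :=
      Equiv.sum_comp (hinv i).toPerm (e i)
    have h2 : ∑ _σ : ι → Bool, α ^ (2 * n) / 2 ≤ ∑ σ, (e i σ + e i (fl i σ)) :=
      Finset.sum_le_sum fun σ _ => hpair i σ
    rw [Finset.sum_add_distrib, h1] at h2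
    simp only [Finset.sum_const, nsmul_eq_mul] at h2 ⊢
    linarith
  have htot : ∑ _σ : ι → Bool, Fintype.card ι * (α ^ (2 * n) / 4) ≤ ∑ σ, ∑ i, e i σ := by
    rw [Finset.sum_comm]
    refine le_trans (le_of_eq ?_) (Finset.sum_le_sum fun i _ => hi i)
    simp only [Finset.sum_const, nsmul_eq_mul, Finset.card_univ]
    ring
  obtain ⟨σ, -, h⟩ := Finset.exists_le_of_sum_le Finset.univ_nonempty htot
  exact ⟨σ, h⟩

/-! ### Designs and the excess risk they force -/

/-- A finite design of points `x i` with two competing classes `a i`, `b i` each: for every sign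
pattern some sparse coefficient array gives the competing classes at each point a score
difference of the prescribed sign and of modulus `t`, all other scores being lower by `M`. -/
structure IsDesign {J ι : Type*} [Fintype J] {L : ℕ} (d₀ : ℕ) (x : ι → J → ℝ)
    (a b : ι → Fin L) : Prop where
  ne : ∀ i, a i ≠ b i
  exists_coef : ∀ M t : ℝ, 0 < M → 0 < t → ∃ B : (ι → Bool) → J → Fin L → ℝ, ∀ σ,
    (∀ l : Fin L, (l : ℕ) + 1 = L → ∀ j, B σ j l = 0) ∧ {j | ∃ l, B σ j l ≠ 0}.ncard ≤ d₀ ∧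
    ∀ i, (∑ j, B σ j (a i) * x i j) - (∑ j, B σ j (b i) * x i j) = (if σ i then t else -t) ∧
      ∀ k, k ≠ a i → k ≠ b i →
        (∑ j, B σ j k * x i j) + M ≤ ∑ j, B σ j (a i) * x i j ∧
        (∑ j, B σ j k * x i j) + M ≤ ∑ j, B σ j (b i) * x i j

/-- A design can be moved to a larger set of coordinates. -/
lemma IsDesign.extend {J J' ι : Type*} [Fintype J] [Fintype J'] {L d₀ : ℕ} {x : ι → J → ℝ}
    {a b : ι → Fin L} (h : IsDesign d₀ x a b) (g : J ↪ J') :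
    IsDesign d₀ (fun i => Function.extend g (x i) 0) a b := by
  refine ⟨h.ne, fun M t hM ht => ?_⟩
  obtain ⟨B, hB⟩ := h.exists_coef M t hM ht
  have hs : ∀ σ i l, ∑ j, Function.extend g (B σ) 0 j l * Function.extend g (x i) 0 j =
      ∑ j, B σ j l * x i j := by
    intro σ i l
    symm
    refine Fintype.sum_of_injective g g.injective _ _ (fun j hj => ?_) fun j => ?_
    · rw [Function.extend_apply' (x i) _ _ (by simpa using hj)]
      simp
    · simp [g.injective.extend_apply]
  refine ⟨fun σ => Function.extend g (B σ) 0, fun σ => ?_⟩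
  beta_reduce
  refine ⟨fun l hl j => ?_, ?_, fun i => ?_⟩
  · by_cases hj : ∃ j', g j' = j
    · obtain ⟨j', rfl⟩ := hj
      rw [g.injective.extend_apply]
      exact (hB σ).1 l hl j'
    · rw [Function.extend_apply' _ _ _ hj]
      rfl
  · refine le_trans ?_ (hB σ).2.1
    rw [← Set.ncard_image_of_injective _ g.injective]
    refine Set.ncard_le_ncard ?_ (Set.toFinite _)
    rintro j ⟨l, hl⟩
    by_cases hj : ∃ j', g j' = j
    · obtain ⟨j', rfl⟩ := hj
      rw [g.injective.extend_apply] at hl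
      exact ⟨j', ⟨l, hl⟩, rfl⟩
    · rw [Function.extend_apply' _ _ _ hj] at hl
      exact absurd rfl hl
  · simp only [hs]
    exact (hB σ).2.2 i

/-- With `ρ = L * exp (-M)` and `u = exp (score B x h)`, the normalising sum is at most `u * (1 +
exp t + ρ)`, and `(1 - ρ) * (1 + exp t + ρ) ≤ 1 + exp t`. For `ρ ≥ 1` the lower bound is trivial. -/
lemma classProb_pair {d L : ℕ} {B : Matrix (Fin d) (Fin L) ℝ} {x : Feat d} {g h : Fin L}
    {t M : ℝ} (hgh : g ≠ h) (hs : score B x g = score B x h + t)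
    (hk : ∀ k, k ≠ g → k ≠ h → score B x k + M ≤ score B x h) :
    classProb B x g = Real.exp t * classProb B x h ∧
      (1 - L * Real.exp (-M)) / (1 + Real.exp t) ≤ classProb B x h := by
  constructor
  · rw [classProb, classProb, hs, Real.exp_add]
    ring
  · set ρ := L * Real.exp (-M) with hρ
    set u := Real.exp (score B x h) with hu
    have hu0 : 0 < u := Real.exp_pos _
    have ht := Real.exp_pos t
    have hρ0 : 0 ≤ ρ := by positivity
    have hZ : ∑ k, Real.exp (score B x k) ≤ u * (1 + Real.exp t + ρ) := by
      have : ∀ k, Real.exp (score B x k) ≤ Real.exp (-M) * u +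
          ((if k = g then Real.exp t * u else 0) + if k = h then u else 0) := by
        intro k
        have h0 : 0 < Real.exp (-M) * u := by positivity
        by_cases h1 : k = g
        · subst h1
          rw [hs, Real.exp_add]
          simp [hgh]
          nlinarith
        by_cases h2 : k = h
        · subst h2
          simp [h1]
          linarith
        simp only [h1, h2, if_false, add_zero]
        rw [hu, ← Real.exp_add]
        gcongr
        linarith [hk k h1 h2]
      refine (Finset.sum_le_sum fun k _ => this k).trans (le_of_eq ?_)
      simp [Finset.sum_add_distrib]
      rw [hρ]
      ring
    have hZ0 : 0 < ∑ k, Real.exp (score B x k) :=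
      Finset.sum_pos (fun _ _ => Real.exp_pos _) ⟨g, Finset.mem_univ _⟩
    rw [classProb, div_le_div_iff₀ (by positivity) hZ0]
    rcases le_total ρ 1 with h1 | h1
    · refine (mul_le_mul_of_nonneg_left hZ (by linarith)).trans ?_
      have : 0 ≤ u * ρ * (Real.exp t + ρ) := by positivity
      rw [← hu]
      nlinarith
    · nlinarith [mul_nonneg (sub_nonneg.2 h1) hZ0.le, mul_pos hu0 ht]

/-- The right side is the Hellinger affinity of two Bernoulli laws with odds `exp t` and `exp (-t)`.
It equals `1 / cosh (t / 2)`, and `cosh u ≤ exp (u ^ 2 / 2)`. -/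
lemma one_sub_le_two_mul_sqrt_exp_div (t : ℝ) :
    1 - t ^ 2 / 8 ≤ 2 * √(Real.exp t) / (1 + Real.exp t) := by
  have h1 : √(Real.exp t) = Real.exp (t / 2) := by
    rw [Real.exp_half]
  have h2 : Real.exp t = Real.exp (t / 2) * Real.exp (t / 2) := by
    rw [← Real.exp_add]; ring_nf
  have h3 : 2 * √(Real.exp t) / (1 + Real.exp t) = (Real.cosh (t / 2))⁻¹ := by
    rw [h1, h2, Real.cosh_eq, Real.exp_neg]
    have := Real.exp_pos (t / 2)
    field_simp
    ring
  rw [h3]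
  have h4 := Real.cosh_le_exp_half_sq (t / 2)
  have h5 : (Real.exp ((t / 2) ^ 2 / 2))⁻¹ ≤ (Real.cosh (t / 2))⁻¹ :=
    inv_anti₀ (Real.cosh_pos _) h4
  rw [← Real.exp_neg] at h5
  have := Real.add_one_le_exp (-((t / 2) ^ 2 / 2))
  linarith

/-- A combination that vanishes almost surely vanishes at each atom of positive mass; at the unit
vectors it reads off the coefficients. -/
lemma isMarginal_atomic {d : ℕ} {κ : Type*} [Fintype κ] {w : κ → ℝ} (hw : ∀ k, 0 ≤ w k)
    (h1 : ∑ k, w k = 1) (y : κ → Feat d)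
    (hy : ∀ j, ∃ k, 0 < w k ∧ y k = Pi.single j 1) : IsMarginal (atomic w y) := by
  refine ⟨isProbabilityMeasure_atomic hw h1 y, fun v hv => ?_⟩
  have hs : MeasurableSet {x : Feat d | ¬ ∑ j, v j * x j = 0} := by
    refine (measurableSet_eq_fun ?_ measurable_const).compl
    fun_prop
  rw [ae_iff, atomic_apply _ _ hs, Finset.sum_eq_zero_iff] at hv
  funext j
  obtain ⟨k, hk, hyk⟩ := hy j
  have := hv k (Finset.mem_univ k)
  by_contra hj
  rw [Set.indicator_of_mem (by simpa [hyk, Pi.single_apply] using hj)] at this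
  simp at this
  linarith

/-- Sparse logistic models on a design with `V` points have minimax excess risk at least of the
order of `t`, if `n * t ^ 2 ≤ 2 * V`. -/
lemma IsDesign.exists_excessRisk_ge {d L d₀ n : ℕ} {ι : Type*} [Fintype ι] [Nonempty ι]
    {x : ι → Feat d} {a b : ι → Fin L} (h : IsDesign d₀ x a b) (hd : 0 < d) {t : ℝ}
    (ht : 0 < t) (ht1 : t ≤ 1) (hn : n * t ^ 2 ≤ 2 * Fintype.card ι)
    (ηt : DataClassifier d L n) :
    ∃ (B : Matrix (Fin d) (Fin L) ℝ) (ηs : Feat d → Fin L) (P : Measure (Feat d)),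
      IsSparseCoef d₀ B ∧ IsLinearClassifier B ηs ∧ IsMarginal P ∧
        t / 256 ≤ excessRisk B P ηt ηs := by
  classical
  obtain ⟨i₀⟩ := ‹Nonempty ι›
  have hL : NeZero L := ⟨by have := (a i₀).2; omega⟩
  have hL0 : (1 : ℝ) ≤ L := by exact_mod_cast hL.one_le
  have hn0 : (0 : ℝ) ≤ n := by positivity
  set V : ℝ := (Fintype.card ι : ℝ) with hV
  have hV1 : 1 ≤ V := by
    rw [hV]; exact_mod_cast Fintype.card_pos_iff.2 ⟨i₀⟩
  have hV0 : 0 < V := by linarith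
  -- `ρ` bounds the mass of the noncompeting classes and `ε` is the mass put on the unit vectors.
  -- Both are of order `1 / n`, so that `(1 - ρ) ^ (2 * n)` and `(1 - ε) ^ (n + 1)` stay at least `1
  -- / 2` by Bernoulli's inequality.
  set ρ : ℝ := 1 / (4 * (n + 1)) with hρ
  have hρ0 : 0 < ρ := by positivity
  have hρn : n * ρ ≤ 1 / 4 := by
    rw [hρ, mul_one_div, div_le_div_iff₀ (by positivity) (by norm_num)]; linarith
  have hρ1 : ρ ≤ 1 / 4 := by
    rw [hρ, div_le_div_iff₀ (by positivity) (by norm_num)]; linarith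
  set ε : ℝ := 1 / (2 * (n + 1)) with hε
  have hε0 : 0 < ε := by positivity
  have hε1 : (n + 1) * ε = 1 / 2 := by rw [hε]; field_simp
  have hεh : ε ≤ 1 / 2 := by nlinarith
  set M : ℝ := Real.log (L / ρ) with hM
  have hM0 : 0 < M := Real.log_pos (by rw [lt_div_iff₀ hρ0]; linarith)
  have hLM : L * Real.exp (-M) = ρ := by
    rw [hM, Real.exp_neg, Real.exp_log (by positivity)]
    field_simp
  obtain ⟨B, hB⟩ : ∃ B : (ι → Bool) → Matrix (Fin d) (Fin L) ℝ, ∀ σ, (IsSparseCoef d₀ (B σ)) ∧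
      ∀ i, score (B σ) (x i) (a i) - score (B σ) (x i) (b i) = (if σ i then t else -t) ∧
        ∀ k, k ≠ a i → k ≠ b i → score (B σ) (x i) k + M ≤ score (B σ) (x i) (a i) ∧
          score (B σ) (x i) k + M ≤ score (B σ) (x i) (b i) := by
    obtain ⟨B, hB⟩ := h.exists_coef M t hM0 ht
    exact ⟨B, fun σ => ⟨⟨(hB σ).1, (hB σ).2.1⟩, (hB σ).2.2⟩⟩
  set E : ℝ := Real.exp t with hE
  have hE0 : 0 < E := Real.exp_pos t
  have hE1 : t ≤ E - 1 := by linarith [Real.add_one_le_exp t]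
  have hE3 : E ≤ 3 :=
    (Real.exp_le_exp.2 ht1).trans (by linarith [Real.exp_one_lt_d9])
  set c : ℝ := (1 - ρ) / (1 + E) with hc
  have hc0 : 0 < c := div_pos (by linarith) (by linarith)
  have hcE : c + E * c = 1 - ρ := by rw [hc]; field_simp
  -- the better and the worse of the two competing classes
  set g : (ι → Bool) → ι → Fin L := fun σ i => if σ i then a i else b i with hg
  set g' : (ι → Bool) → ι → Fin L := fun σ i => if σ i then b i else a i with hg'
  have hpair : ∀ σ i, classProb (B σ) (x i) (g σ i) = E * classProb (B σ) (x i) (g' σ i) ∧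
      c ≤ classProb (B σ) (x i) (g' σ i) := by
    intro σ i
    have := (hB σ).2 i
    rw [hc, ← hLM]
    cases hσ : σ i
    · simp only [hg, hg', hσ] at this ⊢
      refine classProb_pair (h.ne i).symm ?_ fun k hk hk' => (this.2 k hk' hk).1
      simp only [Bool.false_eq_true, if_false] at this ⊢
      linarith [this.1]
    · simp only [hg, hg', hσ] at this ⊢
      refine classProb_pair (h.ne i) ?_ fun k hk hk' => (this.2 k hk hk').2
      simp only [if_true] at this ⊢
      linarith [this.1]
  have hworse : ∀ σ i k, k ≠ g σ i →
      classProb (B σ) (x i) k ≤ classProb (B σ) (x i) (g' σ i) := by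
    intro σ i k hk
    have := (hB σ).2 i
    by_cases hk' : k = g' σ i
    · rw [hk']
    · refine classProb_le_classProb ?_
      cases hσ : σ i <;> simp only [hg, hg', hσ, Bool.false_eq_true, if_false, if_true] at hk hk' ⊢
      · linarith [(this.2 k hk' hk).1]
      · linarith [(this.2 k hk hk').2]
  set p : (ι → Bool) → ι × Fin L → ℝ := fun σ z => V⁻¹ * classProb (B σ) (x z.1) z.2 with hp
  have hp0 : ∀ σ z, 0 ≤ p σ z := fun σ z => mul_nonneg (by positivity) (classProb_nonneg _ _ _)
  have hp1 : ∀ σ, ∑ z, p σ z ≤ 1 := by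
    intro σ
    simp only [hp, Fintype.sum_prod_type, ← Finset.mul_sum, sum_classProb]
    simp only [Finset.sum_const, Finset.card_univ, nsmul_eq_mul, mul_one]
    rw [inv_mul_cancel₀ hV0.ne']
  have htwo : ∀ σ σ' i, √(classProb (B σ) (x i) (a i) * classProb (B σ') (x i) (a i)) +
      √(classProb (B σ) (x i) (b i) * classProb (B σ') (x i) (b i)) ≤
      ∑ l, √(classProb (B σ) (x i) l * classProb (B σ') (x i) l) := by
    intro σ σ' i
    rw [← Finset.sum_pair (h.ne i)
      (f := fun l => √(classProb (B σ) (x i) l * classProb (B σ') (x i) l))]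
    exact Finset.sum_le_sum_of_subset_of_nonneg (Finset.subset_univ _)
      fun _ _ _ => Real.sqrt_nonneg _
  -- Even where the signs agree the two laws may differ, through the noncompeting classes. The
  -- competing pair alone gives affinity `c + E * c = 1 - ρ`.
  have hsame : ∀ σ σ' i, σ i = σ' i →
      1 - ρ ≤ ∑ l, √(classProb (B σ) (x i) l * classProb (B σ') (x i) l) := by
    intro σ σ' i hσ
    refine le_trans ?_ (htwo σ σ' i)
    have h1 := hpair σ i
    have h2 := hpair σ' i
    rw [← hcE]
    simp only [hg, hg', ← hσ] at h1 h2
    cases hσi : σ i <;> simp only [hσi, Bool.false_eq_true, if_false, if_true] at h1 h2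
    · refine add_le_add (Real.le_sqrt_of_sq_le ?_) (Real.le_sqrt_of_sq_le ?_)
      · rw [sq]
        exact mul_le_mul h1.2 h2.2 hc0.le (classProb_nonneg _ _ _)
      · rw [sq, h1.1, h2.1]
        exact mul_le_mul (mul_le_mul_of_nonneg_left h1.2 hE0.le) (mul_le_mul_of_nonneg_left h2.2 hE0.le)
          (by positivity) (mul_nonneg hE0.le (classProb_nonneg _ _ _))
    · rw [add_comm c]
      refine add_le_add (Real.le_sqrt_of_sq_le ?_) (Real.le_sqrt_of_sq_le ?_)
      · rw [sq, h1.1, h2.1]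
        exact mul_le_mul (mul_le_mul_of_nonneg_left h1.2 hE0.le) (mul_le_mul_of_nonneg_left h2.2 hE0.le)
          (by positivity) (mul_nonneg hE0.le (classProb_nonneg _ _ _))
      · rw [sq]
        exact mul_le_mul h1.2 h2.2 hc0.le (classProb_nonneg _ _ _)
  have hdiff : ∀ σ σ' i, (σ' i = !σ i) → (1 - ρ) * (1 - t ^ 2 / 8) ≤
      ∑ l, √(classProb (B σ) (x i) l * classProb (B σ') (x i) l) := by
    intro σ σ' i hσ
    refine le_trans ?_ (htwo σ σ' i)
    have h1 := hpair σ i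
    have h2 := hpair σ' i
    have h3 : (1 - ρ) * (1 - t ^ 2 / 8) ≤ √E * c + √E * c := by
      have := mul_le_mul_of_nonneg_left (one_sub_le_two_mul_sqrt_exp_div t)
        (show 0 ≤ 1 - ρ by linarith)
      refine this.trans (le_of_eq ?_)
      rw [hc]
      ring
    have h4 : (√E * c) ^ 2 = E * c * c := by
      rw [mul_pow, Real.sq_sqrt hE0.le]; ring
    refine h3.trans ?_
    simp only [hg, hg', hσ] at h1 h2
    cases hσi : σ i <;>
      simp only [hσi, Bool.false_eq_true, if_false, if_true, Bool.not_false, Bool.not_true] at h1 h2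
    · refine add_le_add (Real.le_sqrt_of_sq_le ?_) (Real.le_sqrt_of_sq_le ?_)
      · rw [h4, h2.1, mul_left_comm, ← mul_assoc]
        exact mul_le_mul (mul_le_mul_of_nonneg_left h1.2 hE0.le) h2.2 hc0.le
          (mul_nonneg hE0.le (classProb_nonneg _ _ _))
      · rw [h4, h1.1]
        exact mul_le_mul (mul_le_mul_of_nonneg_left h1.2 hE0.le) h2.2 hc0.le
          (mul_nonneg hE0.le (classProb_nonneg _ _ _))
    · refine add_le_add (Real.le_sqrt_of_sq_le ?_) (Real.le_sqrt_of_sq_le ?_)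
      · rw [h4, h1.1]
        exact mul_le_mul (mul_le_mul_of_nonneg_left h1.2 hE0.le) h2.2 hc0.le
          (mul_nonneg hE0.le (classProb_nonneg _ _ _))
      · rw [h4, h2.1, mul_left_comm, ← mul_assoc]
        exact mul_le_mul (mul_le_mul_of_nonneg_left h1.2 hE0.le) h2.2 hc0.le
          (mul_nonneg hE0.le (classProb_nonneg _ _ _))
  set α : ℝ := (1 - ρ) * (1 - t ^ 2 / (8 * V)) with hα
  have htV : t ^ 2 / (8 * V) ≤ 1 / 8 := by
    rw [div_le_div_iff₀ (by positivity) (by norm_num)]; nlinarith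
  have hα0 : 0 ≤ α := mul_nonneg (by linarith) (by linarith)
  have haff : ∀ σ i, α ≤ ∑ z, √(p σ z * p (Function.update σ i (!σ i)) z) := by
    intro σ i
    set σ' := Function.update σ i (!σ i) with hσ'
    have h1 : ∀ i', (1 - ρ) - (if i' = i then (1 - ρ) * (t ^ 2 / 8) else 0) ≤
        ∑ l, √(classProb (B σ) (x i') l * classProb (B σ') (x i') l) := by
      intro i'
      by_cases hi : i' = i
      · subst hi
        have := hdiff σ σ' i' (by simp [hσ'])
        simp only [if_true]
        linarith
      · simpa [hi] using hsame σ σ' i' (by simp [hσ', hi])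
    have h2 := Finset.sum_le_sum fun i' (_ : i' ∈ Finset.univ) => h1 i'
    have h3 : ∑ z, √(p σ z * p σ' z) =
        V⁻¹ * ∑ i', ∑ l, √(classProb (B σ) (x i') l * classProb (B σ') (x i') l) := by
      simp only [Fintype.sum_prod_type, Finset.mul_sum]
      refine Finset.sum_congr rfl fun i' _ => Finset.sum_congr rfl fun l _ => ?_
      rw [hp, ← Real.sqrt_sq (show 0 ≤ V⁻¹ by positivity), ← Real.sqrt_mul (by positivity)]
      congr 1
      rw [Real.sqrt_sq (show 0 ≤ V⁻¹ by positivity)]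
      ring
    rw [h3]
    refine le_trans (le_of_eq ?_) (mul_le_mul_of_nonneg_left h2 (by positivity))
    simp only [Finset.sum_sub_distrib, Finset.sum_const, Finset.card_univ, nsmul_eq_mul,
      Finset.sum_ite_eq', Finset.mem_univ, if_true, ← hV, hα]
    field_simp
  have hαn : 1 / 4 ≤ α ^ (2 * n) := by
    have h1 : 1 / 2 ≤ (1 - ρ) ^ (2 * n) := by
      have := one_add_mul_le_pow (show -2 ≤ -ρ by linarith) (2 * n)
      push_cast at this
      rw [← sub_eq_add_neg] at this
      linarith
    have h2 : 1 / 2 ≤ (1 - t ^ 2 / (8 * V)) ^ (2 * n) := by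
      have := one_add_mul_le_pow (show -2 ≤ -(t ^ 2 / (8 * V)) by linarith) (2 * n)
      push_cast at this
      rw [← sub_eq_add_neg] at this
      have h3 : 2 * n * (t ^ 2 / (8 * V)) ≤ 1 / 2 := by
        rw [mul_div_assoc', div_le_div_iff₀ (by positivity) (by norm_num)]
        linarith
      linarith
    rw [hα, mul_pow]
    nlinarith
  set w : ι ⊕ Fin d → ℝ := Sum.elim (fun _ => (1 - ε) * V⁻¹) (fun _ => ε / d) with hw
  set y : ι ⊕ Fin d → Feat d := Sum.elim x (fun j => Pi.single j 1) with hy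
  have hdR : (0 : ℝ) < d := by exact_mod_cast hd
  have hw0 : ∀ k, 0 ≤ w k := by
    rintro (k | k)
    · exact mul_nonneg (by linarith) (by positivity)
    · simp only [hw, Sum.elim_inr]; positivity
  have hw1 : ∑ k, w k = 1 := by
    simp only [hw, Fintype.sum_sum_type, Sum.elim_inl, Sum.elim_inr, Finset.sum_const,
      Finset.card_univ, nsmul_eq_mul, Fintype.card_fin, ← hV]
    field_simp
    ring
  -- The classifier is read as a test of the sign `σ i`: does it choose `a i` at `x i`? A wrong
  -- answer means that the better class was missed.
  obtain ⟨σ, hσ⟩ := exists_sum_error_ge hp0 hp1 hα0 haff fun i (s : Fin n → ι × Fin L) =>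
    decide (ηt.1 (fun k => (x (s k).1, (s k).2)) (x i) = a i)
  obtain ⟨ηs, hηs⟩ := exists_isLinearClassifier (B σ)
  refine ⟨B σ, ηs, atomic w y, (hB σ).1, hηs,
    isMarginal_atomic hw0 hw1 y fun j => ⟨Sum.inr j, by simp only [hw, Sum.elim_inr]; positivity,
      rfl⟩, ?_⟩
  rw [excessRisk_atomic hw0 hw1 y ηt hηs.1]
  set gap : (Fin n → (ι ⊕ Fin d) × Fin L) → ι ⊕ Fin d → ℝ := fun s k =>
    classProb (B σ) (y k) (ηs (y k)) -
      classProb (B σ) (y k) (ηt.1 (fun i => (y (s i).1, (s i).2)) (y k)) with hgap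
  have hgap0 : ∀ s k, 0 ≤ gap s k := fun s k =>
    sub_nonneg.2 (classProb_le_classProb (hηs.2 _ _))
  -- Only samples lying entirely on the design are kept; the rest contribute nonnegatively.
  let emb : (Fin n → ι × Fin L) ↪ (Fin n → (ι ⊕ Fin d) × Fin L) :=
    ⟨fun s k => (Sum.inl (s k).1, (s k).2), fun s s' hss => by
      funext k
      have := congrFun hss k
      simp only [Prod.mk.injEq, Sum.inl.injEq] at this
      exact Prod.ext this.1 this.2⟩
  have hgapt : ∀ s i, 3 * t / 16 *
      (if decide (ηt.1 (fun k => (x (s k).1, (s k).2)) (x i) = a i) ≠ σ i then 1 else 0) ≤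
      gap (emb s) (Sum.inl i) := by
    intro s i
    split_ifs with hne
    · set l := ηt.1 (fun k => (x (s k).1, (s k).2)) (x i) with hl
      have hlg : l ≠ g σ i := by
        intro hlg
        cases hσi : σ i <;> simp only [hg, hσi, Bool.false_eq_true, if_false, if_true] at hlg hne
        · simp [hlg, (h.ne i).symm] at hne
        · simp [hlg] at hne
      have h1 : classProb (B σ) (x i) (g σ i) ≤ classProb (B σ) (x i) (ηs (x i)) :=
        classProb_le_classProb (hηs.2 _ _)
      have h2 := hworse σ i l hlg
      have h3 := hpair σ i
      have h4 : gap (emb s) (Sum.inl i) =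
        classProb (B σ) (x i) (ηs (x i)) - classProb (B σ) (x i) l := rfl
      have h5 : 3 / 16 ≤ c := by
        rw [hc, div_le_div_iff₀ (by norm_num) (by linarith)]; linarith
      rw [h4, mul_one]
      have h6 : t * (3 / 16) ≤ (E - 1) * classProb (B σ) (x i) (g' σ i) :=
        mul_le_mul hE1 (h5.trans h3.2) (by norm_num) (by linarith)
      linarith [h3.1]
    · simpa using hgap0 _ _
  have hQ0 : ∀ s : Fin n → (ι ⊕ Fin d) × Fin L,
      0 ≤ ∏ i, w (s i).1 * classProb (B σ) (y (s i).1) (s i).2 := fun s =>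
    Finset.prod_nonneg fun i _ => mul_nonneg (hw0 _) (classProb_nonneg _ _ _)
  have hεn : 1 / 2 ≤ (1 - ε) ^ (n + 1) := by
    have := one_add_mul_le_pow (show -2 ≤ -ε by linarith) (n + 1)
    push_cast at this
    rw [← sub_eq_add_neg] at this
    linarith
  calc t / 256 ≤ 1 / 2 * (3 * t / 16) * (1 / 4 / 4) := by linarith
    _ ≤ (1 - ε) ^ (n + 1) * (3 * t / 16) * (α ^ (2 * n) / 4) := by gcongr
    _ = (1 - ε) ^ (n + 1) * (3 * t / 16) * V⁻¹ * (V * (α ^ (2 * n) / 4)) := by field_simp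
    _ ≤ (1 - ε) ^ (n + 1) * (3 * t / 16) * V⁻¹ * ∑ i, ∑ s : Fin n → ι × Fin L,
          (∏ k, p σ (s k)) *
          (if decide (ηt.1 (fun k => (x (s k).1, (s k).2)) (x i) = a i) ≠ σ i then 1 else 0) := by
        have : (0 : ℝ) ≤ 1 - ε := by linarith
        gcongr
    _ = ∑ s : Fin n → ι × Fin L, ((1 - ε) ^ n * ∏ k, p σ (s k)) * ∑ i, (1 - ε) * V⁻¹ *
          (3 * t / 16 *
          (if decide (ηt.1 (fun k => (x (s k).1, (s k).2)) (x i) = a i) ≠ σ i then 1 else 0)) := by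
        rw [Finset.sum_comm]
        simp only [Finset.mul_sum]
        refine Finset.sum_congr rfl fun s _ => Finset.sum_congr rfl fun i _ => ?_
        ring
    _ ≤ ∑ s : Fin n → ι × Fin L, (∏ i, w (emb s i).1 * classProb (B σ) (y (emb s i).1) (emb s i).2) *
          ∑ k, w k * gap (emb s) k := by
        refine Finset.sum_le_sum fun s _ => ?_
        have h1 : (1 - ε) ^ n * ∏ k, p σ (s k) =
            ∏ i, w (emb s i).1 * classProb (B σ) (y (emb s i).1) (emb s i).2 := by
          have : (1 - ε) ^ n = ∏ _k : Fin n, (1 - ε) := by simp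
          rw [this, ← Finset.prod_mul_distrib]
          exact Finset.prod_congr rfl fun k _ => (mul_assoc _ _ _).symm
        rw [h1]
        refine mul_le_mul_of_nonneg_left ?_ (hQ0 _)
        rw [Fintype.sum_sum_type]
        refine le_add_of_le_of_nonneg (Finset.sum_le_sum fun i _ => ?_)
          (Finset.sum_nonneg fun j _ => mul_nonneg (hw0 _) (hgap0 _ _))
        exact mul_le_mul_of_nonneg_left (hgapt s i) (hw0 (Sum.inl i))
    _ = ∑ s ∈ Finset.univ.map emb, (∏ i, w (s i).1 * classProb (B σ) (y (s i).1) (s i).2) *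
          ∑ k, w k * gap s k := by rw [Finset.sum_map]
    _ ≤ _ := Finset.sum_le_sum_of_subset_of_nonneg (Finset.subset_univ _) fun s _ _ =>
        mul_nonneg (hQ0 _) (Finset.sum_nonneg fun k _ => mul_nonneg (hw0 _) (hgap0 _ _))

/-! ### The cube design, for the logarithmic term -/

/-- The sign `±1` of a Boolean. -/
def sgn (b : Bool) : ℝ := if b then 1 else -1

lemma sgn_mul_beq (b b' : Bool) : sgn b * sgn (b' == b) = sgn b' := by
  cases b <;> cases b' <;> simp [sgn]

lemma abs_sgn (b : Bool) : |sgn b| = 1 := by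
  cases b <;> simp [sgn]

lemma sgn_mul (b : Bool) (t : ℝ) : sgn b * t = if b then t else -t := by
  cases b <;> simp [sgn]

/-- The points of the binary design: `s` blocks of coordinates, each indexed by the vertices of a
`q`-dimensional cube, and `c` constant coordinates. In a block, one point is constant and the
others are the coordinates of the cube. -/
def cubePoint (c s q : ℕ) (z : Fin s × Option (Fin q)) :
    Fin c ⊕ (Fin s × (Fin q → Bool)) → ℝ :=
  Sum.elim (fun _ => 1) fun u =>
    if u.1 = z.1 then z.2.elim 1 (fun k => sgn (u.2 k)) else 0

/-- Logistic models with two active classes and one nonzero row in each of `s` blocks. -/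
lemma isDesign_cubePoint {L : ℕ} (hL : 2 ≤ L) (c s q : ℕ) (hc : L = 2 ∨ c = 1) :
    IsDesign (c + s) (cubePoint c s q) (fun _ => (⟨0, by omega⟩ : Fin L))
      (fun _ => (⟨L - 1, by omega⟩ : Fin L)) := by
  classical
  refine ⟨fun _ h => by simp [Fin.ext_iff] at h; omega, fun M t hM ht => ?_⟩
  set a : Fin L := ⟨0, by omega⟩ with ha
  set b : Fin L := ⟨L - 1, by omega⟩ with hb
  have hab : a ≠ b := fun h => by simp [ha, hb, Fin.ext_iff] at h; omega
  -- In each block the row at this vertex carries the sign of the constant point; the vertex records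
  -- the other signs relative to it (`==` is the product of signs). The constant coordinate is only
  -- needed to push down third classes.
  let f : (Fin s × Option (Fin q) → Bool) → Fin s → Fin q → Bool :=
    fun σ u k => σ (u, some k) == σ (u, none)
  let B : (Fin s × Option (Fin q) → Bool) → Fin c ⊕ (Fin s × (Fin q → Bool)) → Fin L → ℝ :=
    fun σ => Sum.elim (fun _ l => if l = a ∨ l = b then 0 else -(M + t))
      fun u l => if l = a ∧ u.2 = f σ u.1 then sgn (σ (u.1, none)) * t else 0
  have hsa : ∀ σ z, ∑ j, B σ j a * cubePoint c s q z j = sgn (σ z) * t := by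
    rintro σ ⟨u, k⟩
    rw [Fintype.sum_sum_type, Fintype.sum_prod_type, Finset.sum_eq_single u, Finset.sum_eq_single
      (f σ u)]
    · cases k with
      | none => simp [B, cubePoint]
      | some k =>
        simp only [B, cubePoint, Sum.elim_inl, Sum.elim_inr]
        simp only [true_or, if_true, zero_mul, Finset.sum_const_zero, and_self, Option.elim_some,
          zero_add, f]
        rw [mul_right_comm, sgn_mul_beq]
    · intro v _ hv
      simp [B, hv]
    · simp
    · intro v _ hv
      simp [cubePoint, hv]
    · simp
  have hsb : ∀ σ z, ∑ j, B σ j b * cubePoint c s q z j = 0 := by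
    intro σ z
    refine Finset.sum_eq_zero fun j _ => ?_
    rcases j with j | j <;> simp [B, hab.symm]
  refine ⟨B, fun σ => ⟨fun l hl j => ?_, ?_, fun z => ⟨?_, fun k hka hkb => ?_⟩⟩⟩
  · have : l = b := Fin.ext (by simp [hb]; omega)
    subst this
    rcases j with j | j <;> simp [B, hab.symm]
  · let r : Fin c ⊕ Fin s → Fin c ⊕ (Fin s × (Fin q → Bool)) :=
      Sum.map id fun u => (u, f σ u)
    have hsub : {j | ∃ l, B σ j l ≠ 0} ⊆ r '' Set.univ := by
      rintro (j | ⟨u, v⟩) ⟨l, hl⟩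
      · exact ⟨Sum.inl j, trivial, rfl⟩
      · refine ⟨Sum.inr u, trivial, ?_⟩
        simp only [B, Sum.elim_inr, ne_eq, ite_eq_right_iff, not_forall] at hl
        simp [r, hl.1.2]
    refine (Set.ncard_le_ncard hsub (Set.toFinite _)).trans
      ((Set.ncard_image_le (Set.toFinite _)).trans ?_)
    simp [Set.ncard_univ]
  · rw [hsa, hsb, sub_zero, sgn_mul]
  · have hLc : c = 1 := by
      refine hc.resolve_left fun h2 => ?_
      have h0 : (k : ℕ) ≠ 0 := fun h => hka (Fin.ext h)
      have h1 : (k : ℕ) ≠ L - 1 := fun h => hkb (Fin.ext h)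
      have := k.2
      omega
    have hsk : ∑ j, B σ j k * cubePoint c s q z j = -(M + t) := by
      rw [Fintype.sum_sum_type]
      simp [B, cubePoint, hka, hkb, hLc]
    have := abs_le.1 (abs_sgn (σ z)).le
    rw [hsa, hsb, hsk]
    constructor <;> nlinarith

/-! ### The parabola design, for the term linear in the number of classes -/

/-- The points of the parabola design: position `i + 1` on the first coordinate, an intercept, and
possibly one further active coordinate. -/
def parabolaPoint (r N : ℕ) (z : Option (Fin r) × Fin N) : Option (Option (Fin r)) → ℝ
  | none => z.2 + 1
  | some none => 1
  | some (some j) => if z.1 = some j then 1 else 0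

/-- Logistic models with `L - 1 ≥ 2 * N` proper classes grouped in `N` competing pairs. -/
lemma isDesign_parabolaPoint {L : ℕ} (r N : ℕ) (hN : 2 * N + 1 ≤ L) :
    IsDesign (r + 2) (parabolaPoint r N) (fun z => (⟨2 * z.2, by omega⟩ : Fin L))
      (fun z => (⟨2 * z.2 + 1, by omega⟩ : Fin L)) := by
  classical
  refine ⟨fun _ h => by simp [Fin.ext_iff] at h, fun M t hM ht => ?_⟩
  -- the signs of class `l`, as the array of the intercept and the remaining coordinates
  let e : ℕ → ℝ := fun l => if l % 2 = 0 then t / 2 else -(t / 2)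
  let τ : (Option (Fin r) × Fin N → Bool) → Option (Fin r) → ℕ → ℝ :=
    fun σ j l => if h : l / 2 < N then sgn (σ (j, ⟨l / 2, h⟩)) * e l else 0
  -- Curvature of the parabola: neighbouring pairs lie at least `K` lower, and the tilts of modulus
  -- `t / 2` on either side use up at most `t` of this margin.
  let K := M + t
  -- The intercept carries the tilt of the point `none`; coordinate `j` replaces it by the tilt of
  -- `some j`.
  let B : (Option (Fin r) × Fin N → Bool) → Option (Option (Fin r)) → Fin L → ℝ := fun σ j l =>
    if (l : ℕ) < 2 * N then
      match j with
      | none => K * (2 * ((l / 2 : ℕ) + 1))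
      | some none => -(K * ((l / 2 : ℕ) + 1) ^ 2) + τ σ none l
      | some (some j) => τ σ (some j) l - τ σ none l
    else 0
  have hs : ∀ σ (z : Option (Fin r) × Fin N) (l : Fin L), (l : ℕ) < 2 * N →
      ∑ j, B σ j l * parabolaPoint r N z j =
        K * (((z.2 : ℕ) + 1) ^ 2 - (((l / 2 : ℕ) : ℝ) - (z.2 : ℕ)) ^ 2) + τ σ z.1 l := by
    rintro σ ⟨j, i⟩ l hl
    have h0 : ∑ j', B σ (some (some j')) l * parabolaPoint r N (j, i) (some (some j')) =
        τ σ j l - τ σ none l := by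
      cases j with
      | none => simp [parabolaPoint]
      | some j => simp [parabolaPoint, B, hl]
    rw [Fintype.sum_option, Fintype.sum_option, h0]
    simp only [B, hl, if_true, parabolaPoint]
    ring
  have hs0 : ∀ σ (z : Option (Fin r) × Fin N) (l : Fin L), ¬ (l : ℕ) < 2 * N →
      ∑ j, B σ j l * parabolaPoint r N z j = 0 := by
    intro σ z l hl
    simp [B, hl]
  have he : ∀ l, |e l| = t / 2 := by
    intro l
    simp only [e]
    split_ifs
    · rw [abs_of_pos (by positivity)]
    · rw [abs_neg, abs_of_pos (by positivity)]
  have hτ : ∀ σ j l, -(t / 2) ≤ τ σ j l ∧ τ σ j l ≤ t / 2 := by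
    intro σ j l
    rw [← abs_le]
    simp only [τ]
    split_ifs
    · rw [abs_mul, abs_sgn, he, one_mul]
    · simp; positivity
  have hK : 0 < K := by positivity
  refine ⟨B, fun σ => ⟨fun l hl j => ?_, ?_, ?_⟩⟩
  · have : ¬ (l : ℕ) < 2 * N := by omega
    simp [B, this]
  · refine (Set.ncard_le_ncard (Set.subset_univ _) (Set.toFinite _)).trans ?_
    simp [Set.ncard_univ]
  · rintro ⟨j, i⟩
    have hi := i.2
    have hd1 : (2 * (i : ℕ) + 1) / 2 = i := by omega
    have ha := hs σ (j, i) ⟨2 * i, by omega⟩ (by simp)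
    have hb := hs σ (j, i) ⟨2 * i + 1, by omega⟩ (by simp; omega)
    have hτa : τ σ j (2 * i) = sgn (σ (j, i)) * (t / 2) := by
      simp [τ, e]
    have hτb : τ σ j (2 * i + 1) = sgn (σ (j, i)) * -(t / 2) := by
      simp [τ, e, hd1]
    simp only [Nat.mul_div_cancel_left _ (show 0 < 2 by norm_num), hd1, sub_self, hτa, hτb] at ha hb
    simp only [ha, hb]
    have hsg := abs_le.1 (abs_sgn (σ (j, i))).le
    refine ⟨by rw [← sgn_mul]; ring, fun k hka hkb => ?_⟩
    -- Positions start at `1`, so the winning pair also beats the classes with zero score, among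
    -- them the reference class, by the same margin.
    have hi1 : (1 : ℝ) ≤ ((i : ℕ) + 1) ^ 2 := by
      have : (0 : ℝ) ≤ (i : ℕ) := by positivity
      nlinarith
    have hk : ∑ j', B σ j' k * parabolaPoint r N (j, i) j' ≤
        K * (((i : ℕ) + 1) ^ 2 - 1) + t / 2 := by
      by_cases hkN : (k : ℕ) < 2 * N
      · rw [hs σ _ k hkN]
        have hne : ((k / 2 : ℕ) : ℤ) - (i : ℕ) ≠ 0 := by
          intro h0
          have h1 : (k : ℕ) ≠ 2 * i := fun h => hka (Fin.ext h)
          have h2 : (k : ℕ) ≠ 2 * i + 1 := fun h => hkb (Fin.ext h)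
          omega
        have hsq : (1 : ℝ) ≤ (((k / 2 : ℕ) : ℝ) - (i : ℕ)) ^ 2 := by
          have : (1 : ℤ) ≤ (((k / 2 : ℕ) : ℤ) - (i : ℕ)) ^ 2 := by
            have := sq_pos_of_ne_zero hne
            omega
          exact_mod_cast this
        have := (hτ σ j k).2
        gcongr
      · rw [hs0 σ _ k hkN]
        have := mul_nonneg hK.le (sub_nonneg.2 hi1)
        linarith
    have hKt : K = M + t := rfl
    have h1 : sgn (σ (j, i)) * (t / 2) ≤ t / 2 := by nlinarith
    have h2 : -(t / 2) ≤ sgn (σ (j, i)) * (t / 2) := by nlinarith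
    constructor <;> nlinarith

/-! ### From designs to the minimax bound -/

/-- The minimax lower bound given by a design on at most `d` coordinates. -/
lemma IsDesign.le_minimaxExcessRisk {d L d₀ n : ℕ} {J ι : Type*} [Fintype J] [Fintype ι]
    {x : ι → J → ℝ} {a b : ι → Fin L} (h : IsDesign d₀ x a b) (hd : 0 < d)
    (hJ : Fintype.card J ≤ d) {Q : ℝ} (hQ0 : 0 < Q) (hQ : Q ≤ 12 * Fintype.card ι)
    (hQn : Q ≤ 2 * n) :
    ((1 / 768 * √(Q / n) : ℝ) : EReal) ≤ minimaxExcessRisk d L d₀ n := by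
  obtain ⟨g⟩ := Function.Embedding.nonempty_of_card_le
    (show Fintype.card J ≤ Fintype.card (Fin d) by simpa using hJ)
  have hι : Nonempty ι := by
    rw [← Fintype.card_pos_iff, ← Nat.cast_pos (α := ℝ)]
    linarith
  have hn : (0 : ℝ) < n := by linarith
  have ht0 : 0 < √(Q / n) := Real.sqrt_pos.2 (by positivity)
  have hsq : √(Q / n) ^ 2 = Q / n := Real.sq_sqrt (by positivity)
  have hQ2 : Q / n ≤ 2 := by rwa [div_le_iff₀ hn]
  refine le_iInf fun ηt => ?_
  obtain ⟨B, ηs, P, hB, hηs, hP, hle⟩ := (h.extend g).exists_excessRisk_ge hd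
    (t := √(Q / n) / 3) (by positivity) (by nlinarith)
    (by rw [div_pow, hsq]; field_simp; linarith) ηt
  refine le_iSup₂_of_le B hB (le_iSup₂_of_le ηs hηs (le_iSup₂_of_le P hP ?_))
  rw [EReal.coe_le_coe_iff]
  linarith

/-- The logarithm is `1 + log (d / d₀)` and `d / d₀ ≤ 2 ^ (q + 1)` for `q = Nat.log 2 (d / d₀)`.
This compares the target rate with the `q + 1` points per block of the cube design. -/
lemma log_mul_exp_div_le {d d₀ : ℕ} (h0 : 0 < d₀) (hd : d₀ ≤ d) :
    Real.log (d * Real.exp 1 / d₀) ≤ 2 * (Nat.log 2 (d / d₀) + 1 : ℕ) := by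
  have h0' : (0 : ℝ) < d₀ := by exact_mod_cast h0
  have hd' : (0 : ℝ) < d := by exact_mod_cast h0.trans_le hd
  have h1 : d < d₀ * 2 ^ (Nat.log 2 (d / d₀) + 1) := by
    have h2 := Nat.lt_pow_succ_log_self (by norm_num : 1 < 2) (d / d₀)
    calc d < d₀ * (d / d₀ + 1) := Nat.lt_mul_div_succ d h0
      _ ≤ _ := Nat.mul_le_mul_left _ h2
  have h2 : (d : ℝ) / d₀ ≤ 2 ^ (Nat.log 2 (d / d₀) + 1) := by
    rw [div_le_iff₀' h0']
    exact_mod_cast h1.le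
  have h3 := Real.log_le_log (by positivity) h2
  rw [Real.log_pow] at h3
  rw [mul_div_right_comm, Real.log_mul (by positivity) (by positivity), Real.log_exp]
  have h4 : (1 : ℝ) ≤ (Nat.log 2 (d / d₀) + 1 : ℕ) := by simp
  nlinarith [Real.log_two_lt_d9]

end SparseMultinomial

end

open SparseMultinomial

theorem theorem2 :
    ∃ C₂ : ℝ, 0 < C₂ ∧
      ∀ d L d₀ n : ℕ, 2 ≤ L → d₀ ≤ d → (2 ≤ d₀ ∨ L = 2) →
        2 ≤ (d₀ : ℝ) * Real.log ((d : ℝ) * Real.exp 1 / (d₀ : ℝ)) →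
        (d₀ : ℝ) * Real.log ((d : ℝ) * Real.exp 1 / (d₀ : ℝ)) ≤ (n : ℝ) →
        (d₀ : ℝ) * ((L : ℝ) - 1) ≤ (n : ℝ) →
        ((C₂ * Real.sqrt (((d₀ : ℝ) * ((L : ℝ) - 1) +
            (d₀ : ℝ) * Real.log ((d : ℝ) * Real.exp 1 / (d₀ : ℝ))) / (n : ℝ)) : ℝ) : EReal)
          ≤ SparseMultinomial.minimaxExcessRisk d L d₀ n := by
  refine ⟨1 / 768, by norm_num, fun d L d₀ n hL hd hdL h2 hlog hLn => ?_⟩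
  have h0 : 0 < d₀ := by
    rcases Nat.eq_zero_or_pos d₀ with h | h
    · subst h; norm_num at h2
    · exact h
  have h0' : (0 : ℝ) < d₀ := by exact_mod_cast h0
  have hL' : (2 : ℝ) ≤ L := by exact_mod_cast hL
  have hd0 : 0 < d := h0.trans_le hd
  set l := Real.log ((d : ℝ) * Real.exp 1 / (d₀ : ℝ)) with hl
  have hpos : 0 < (d₀ : ℝ) * ((L : ℝ) - 1) + d₀ * l :=
    add_pos_of_nonneg_of_pos (mul_nonneg h0'.le (by linarith)) (by linarith)
  have hl1 : 1 ≤ l := by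
    have h1 : (1 : ℝ) ≤ d / d₀ := by
      rw [one_le_div h0']
      exact_mod_cast hd
    rw [hl, mul_div_right_comm, Real.log_mul (by positivity) (by positivity), Real.log_exp]
    linarith [Real.log_nonneg h1]
  -- The dominant term selects the design; the sum is at most twice that term.
  by_cases hcase : 3 ≤ L ∧ (d₀ : ℝ) * l ≤ d₀ * ((L : ℝ) - 1)
  · obtain ⟨hL3, hcase⟩ := hcase
    have hd2 : 2 ≤ d₀ := by omega
    obtain ⟨r, rfl⟩ : ∃ r, d₀ = r + 2 := ⟨d₀ - 2, by omega⟩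
    refine (isDesign_parabolaPoint (L := L) r ((L - 1) / 2) (by omega)).le_minimaxExcessRisk hd0
      (by simp only [Fintype.card_option, Fintype.card_fin]; omega) hpos ?_ (by linarith)
    -- The factor `12`: `2 * d₀ * (L - 1)` is at most `6 * d₀` times the number of pairs, and `d₀ ≤
    -- 2 * (d₀ - 1)`.
    have h3 : L ≤ 3 * ((L - 1) / 2) + 1 := by omega
    have h3' : (L : ℝ) ≤ 3 * ((L - 1) / 2 : ℕ) + 1 := by exact_mod_cast h3
    simp only [Fintype.card_prod, Fintype.card_option, Fintype.card_fin]
    push_cast at hcase ⊢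
    nlinarith [mul_le_mul_of_nonneg_left h3' h0'.le]
  · have hcase' : (d₀ : ℝ) * ((L : ℝ) - 1) ≤ d₀ * l := by
      by_cases hL3 : 3 ≤ L
      · exact (not_le.1 fun h => hcase ⟨hL3, h⟩).le
      · have : L = 2 := by omega
        subst this
        refine mul_le_mul_of_nonneg_left ?_ h0'.le
        norm_num
        linarith
    have hq := log_mul_exp_div_le h0 hd
    rw [← hl] at hq
    set q := Nat.log 2 (d / d₀)
    have hpow : d₀ * 2 ^ q ≤ d := by
      have h1 : 2 ^ q ≤ d / d₀ := Nat.pow_log_le_self 2 (Nat.div_pos hd h0).ne'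
      exact (Nat.mul_le_mul_left _ h1).trans (Nat.mul_div_le d d₀)
    -- One row is spent on the constant coordinate unless `d₀ = 1`, where `L = 2` leaves no third
    -- class to suppress.
    obtain ⟨c, s, hcs, hc, hs⟩ : ∃ c s : ℕ, c + s = d₀ ∧ (L = 2 ∨ c = 1) ∧ d₀ ≤ 2 * s := by
      by_cases h : 2 ≤ d₀
      · exact ⟨1, d₀ - 1, by omega, Or.inr rfl, by omega⟩
      · exact ⟨0, d₀, by omega, by omega, by omega⟩
    have hdesign := isDesign_cubePoint hL c s q hc
    rw [hcs] at hdesign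
    refine hdesign.le_minimaxExcessRisk hd0 ?_ hpos ?_ (by linarith)
    · simp only [Fintype.card_sum, Fintype.card_prod, Fintype.card_fin, Fintype.card_pi,
        Fintype.card_bool, Finset.prod_const, Finset.card_univ]
      have h1 : 1 ≤ 2 ^ q := Nat.one_le_two_pow
      calc c + s * 2 ^ q ≤ c * 2 ^ q + s * 2 ^ q := by nlinarith
        _ = d₀ * 2 ^ q := by rw [← hcs]; ring
        _ ≤ d := hpow
    · simp only [Fintype.card_prod, Fintype.card_option, Fintype.card_fin]
      have hs' : (d₀ : ℝ) ≤ 2 * s := by exact_mod_cast hs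
      have h1 := mul_le_mul_of_nonneg_left hq h0'.le
      have h2 := mul_le_mul_of_nonneg_right hs' (Nat.cast_nonneg (α := ℝ) (q + 1))
      push_cast at h1 h2 ⊢
      nlinarith
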